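/- A (bivariate) copula is a function $C\colon[0,1]^2\to[0,1]$ with $C(t,0)=C(0,t)=0$ and $C(t,1)=C(1,t)=t$ for all $t\in[0,1]$ that is 2-increasing, i.e. $C(u_2,v_2)-C(u_2,v_1)-C(u_1,v_2)+C(u_1,v_1)\ge 0$ whenever $u_1\le u_2$ and $v_1\le v_2$. A quasi-copula satisfies the same boundary conditions and, instead of being 2-increasing, is non-decreasing in each variable and satisfies $|Q(u_1,v_1)-Q(u_2,v_2)|\le|u_1-u_2|+|v_1-v_2|$; it is proper if it is not a copula. Let $W(u,v)=\max(0,u+v-1)$ and $M(u,v)=\min(u,v)$. The Gini's gamma of a copula $C$ is $$\gamma(C)=4\int_0^1\left[C(u,u)+C(u,1-u)\right]du-2 .$$ For $t\in[-1,1]$ let $\underline{G}_t$ be the pointwise infimum of all copulas with Gini's gamma equal to $t$, $$\underline{G}_t(u,v)=\inf\{C(u,v)\colon C\text{ is a copula and }\gamma(C)=t\},\qquad (u,v)\in[0,1]^2 .$$ Then, for $t\in[-1,1]$: (a) $\underline{G}_1=M$; (b) $\underline{G}_t$ is a proper quasi-copula if and only if $0<t<1$; (c) $\underline{G}_t$ is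 a copula different from $M$ and $W$ if and only if $-1/2<t\le 0$; (d) $\underline{G}_t=W$ if and only if $-1\le t\le -1/2$. -/

import Mathlib

open scoped unitInterval
open MeasureTheory Set

/-- The boundary conditions and the range condition common to bivariate copulas and
quasi-copulas: `C` maps `[0,1]²` into `[0,1]`, `C(t,0) = C(0,t) = 0`, `C(t,1) = C(1,t) = t`. -/
structure HasCopulaBoundary (C : I → I → ℝ) : Prop where
  mem_Icc : ∀ u v : I, C u v ∈ Icc (0 : ℝ) 1
  right_zero : ∀ t : I, C t 0 = 0
  left_zero : ∀ t : I, C 0 t = 0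
  right_one : ∀ t : I, C t 1 = t
  left_one : ∀ t : I, C 1 t = t

/-- Bivariate copulas: boundary conditions and the 2-increasing property. -/
structure IsCopula (C : I → I → ℝ) : Prop extends HasCopulaBoundary C where
  two_increasing : ∀ u₁ u₂ v₁ v₂ : I, u₁ ≤ u₂ → v₁ ≤ v₂ →
    0 ≤ C u₂ v₂ - C u₂ v₁ - C u₁ v₂ + C u₁ v₁

/-- Bivariate quasi-copulas: boundary conditions, monotone in each variable, and Lipschitz
(constant `1`) for the `ℓ¹` distance. -/
structure IsQuasiCopula (Q : I → I → ℝ) : Prop extends HasCopulaBoundary Q where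
  mono_left : ∀ v u₁ u₂ : I, u₁ ≤ u₂ → Q u₁ v ≤ Q u₂ v
  mono_right : ∀ u v₁ v₂ : I, v₁ ≤ v₂ → Q u v₁ ≤ Q u v₂
  lipschitz : ∀ u₁ v₁ u₂ v₂ : I,
    |Q u₁ v₁ - Q u₂ v₂| ≤ |(u₁ : ℝ) - u₂| + |(v₁ : ℝ) - v₂|

/-- A proper quasi-copula is a quasi-copula that is not a copula. -/
def IsProperQuasiCopula (Q : I → I → ℝ) : Prop :=
  IsQuasiCopula Q ∧ ¬ IsCopula Q

/-- The lower Fréchet-Hoeffding bound `W(u,v) = max(0, u + v - 1)`. -/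
noncomputable def copulaW (u v : I) : ℝ := max 0 ((u : ℝ) + v - 1)

/-- The upper Fréchet-Hoeffding bound `M(u,v) = min(u, v)`. -/
noncomputable def copulaM (u v : I) : ℝ := min (u : ℝ) v

/-- Gini's gamma `γ(C) = 4 ∫₀¹ [C(u,u) + C(u,1-u)] du - 2`; here `σ u = 1 - u`. -/
noncomputable def giniGamma (C : I → I → ℝ) : ℝ :=
  4 * (∫ u : I, (C u u + C u (σ u))) - 2

/-- The set `𝐆_t` of all copulas `C` with `γ(C) = t`. -/
def giniClass (t : ℝ) : Set (I → I → ℝ) :=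
  {C | IsCopula C ∧ giniGamma C = t}

/-- The pointwise infimum of `𝐆_t`. -/
noncomputable def giniInf (t : ℝ) (u v : I) : ℝ :=
  sInf {x : ℝ | ∃ C ∈ giniClass t, C u v = x}

/-! The infimum is a genuine one: for `t ∈ [-1,1]` the class is non-empty, and the values are
bounded below. -/

theorem isCopula_copulaW : IsCopula copulaW where
  mem_Icc u v := by
    have := u.2.2; have := v.2.2
    simp only [copulaW, mem_Icc]
    exact ⟨le_max_left _ _, max_le zero_le_one (by linarith)⟩
  right_zero t := by have := t.2.2; simp [copulaW]; linarith
  left_zero t := by have := t.2.2; simp [copulaW]; linarith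
  right_one t := by have := t.2.1; simp [copulaW]; linarith
  left_one t := by have := t.2.1; simp [copulaW]; linarith
  two_increasing u₁ u₂ v₁ v₂ hu hv := by
    have hu' : (u₁ : ℝ) ≤ u₂ := hu
    have hv' : (v₁ : ℝ) ≤ v₂ := hv
    simp only [copulaW]
    rcases max_cases (0 : ℝ) ((u₂ : ℝ) + v₂ - 1) with h1 | h1 <;>
    rcases max_cases (0 : ℝ) ((u₂ : ℝ) + v₁ - 1) with h2 | h2 <;>
    rcases max_cases (0 : ℝ) ((u₁ : ℝ) + v₂ - 1) with h3 | h3 <;>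
    rcases max_cases (0 : ℝ) ((u₁ : ℝ) + v₁ - 1) with h4 | h4 <;>
    linarith

theorem isCopula_copulaM : IsCopula copulaM where
  mem_Icc u v := by
    simp only [copulaM, mem_Icc]
    exact ⟨le_min u.2.1 v.2.1, (min_le_left _ _).trans u.2.2⟩
  right_zero t := by have := t.2.1; simp [copulaM]; linarith
  left_zero t := by have := t.2.1; simp [copulaM]; linarith
  right_one t := by have := t.2.2; simp [copulaM]; linarith
  left_one t := by have := t.2.2; simp [copulaM]; linarith
  two_increasing u₁ u₂ v₁ v₂ hu hv := by
    have hu' : (u₁ : ℝ) ≤ u₂ := hu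
    have hv' : (v₁ : ℝ) ≤ v₂ := hv
    simp only [copulaM]
    rcases min_cases (u₂ : ℝ) (v₂ : ℝ) with h1 | h1 <;>
    rcases min_cases (u₂ : ℝ) (v₁ : ℝ) with h2 | h2 <;>
    rcases min_cases (u₁ : ℝ) (v₂ : ℝ) with h3 | h3 <;>
    rcases min_cases (u₁ : ℝ) (v₁ : ℝ) with h4 | h4 <;>
    linarith

theorem integral_I_eq_intervalIntegral (f : ℝ → ℝ) :
    ∫ u : I, f u = ∫ u in (0 : ℝ)..1, f u := by
  rw [intervalIntegral.integral_of_le zero_le_one, ← integral_Icc_eq_integral_Ioc]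
  exact unitInterval.measurePreserving_coe.integral_comp
    unitInterval.measurableEmbedding_coe f

theorem giniGamma_copulaW : giniGamma copulaW = -1 := by
  have h : ∀ u : I, copulaW u u + copulaW u (σ u) = (fun x : ℝ => max 0 (2 * x - 1)) u := by
    intro u
    simp [copulaW, two_mul]
  have hc : Continuous (fun x : ℝ => max 0 (2 * x - 1)) := by fun_prop
  simp only [giniGamma, h]
  rw [integral_I_eq_intervalIntegral (fun x : ℝ => max 0 (2 * x - 1)),
    ← intervalIntegral.integral_add_adjacent_intervals (b := 1 / 2)
      (hc.intervalIntegrable _ _) (hc.intervalIntegrable _ _)]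
  have h1 : ∫ x in (0 : ℝ)..(1 / 2), max 0 (2 * x - 1) = ∫ x in (0 : ℝ)..(1 / 2), (0 : ℝ) := by
    refine intervalIntegral.integral_congr fun x hx => ?_
    rw [uIcc_of_le (by norm_num)] at hx
    exact max_eq_left (by linarith [hx.2])
  have h2 : ∫ x in (1 / 2 : ℝ)..1, max 0 (2 * x - 1) = ∫ x in (1 / 2 : ℝ)..1, (2 * x - 1) := by
    refine intervalIntegral.integral_congr fun x hx => ?_
    rw [uIcc_of_le (by norm_num)] at hx
    exact max_eq_right (by linarith [hx.1])
  rw [h1, h2, intervalIntegral.integral_sub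
    (Continuous.intervalIntegrable (by fun_prop) _ _)
    (Continuous.intervalIntegrable (by fun_prop) _ _),
    intervalIntegral.integral_const_mul, integral_id]
  norm_num

theorem integrable_copulaW_diag : Integrable fun u : I => copulaW u u + copulaW u (σ u) := by
  have : Continuous fun u : I => copulaW u u + copulaW u (σ u) := by
    unfold copulaW; fun_prop
  exact this.integrable_of_hasCompactSupport (HasCompactSupport.of_compactSpace _)

theorem integrable_copulaM_diag : Integrable fun u : I => copulaM u u + copulaM u (σ u) := by
  have : Continuous fun u : I => copulaM u u + copulaM u (σ u) := by
    unfold copulaM; fun_prop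
  exact this.integrable_of_hasCompactSupport (HasCompactSupport.of_compactSpace _)

theorem giniGamma_copulaM : giniGamma copulaM = 1 := by
  have h : ∀ u : I, copulaM u u + copulaM u (σ u)
      = (fun x : ℝ => 2 * x) u - (copulaW u u + copulaW u (σ u)) := by
    intro u
    simp only [copulaM, copulaW, unitInterval.coe_symm_eq, min_self]
    rcases min_cases (u : ℝ) (1 - u) with h1 | h1 <;>
    rcases max_cases (0 : ℝ) ((u : ℝ) + u - 1) with h2 | h2 <;>
    rcases max_cases (0 : ℝ) ((u : ℝ) + (1 - u) - 1) with h3 | h3 <;>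
    linarith
  have hW := giniGamma_copulaW
  have hi : Integrable fun u : I => (fun x : ℝ => 2 * x) u := by
    have : Continuous fun u : I => (fun x : ℝ => 2 * x) u := by fun_prop
    exact this.integrable_of_hasCompactSupport (HasCompactSupport.of_compactSpace _)
  have h2 : ∫ u : I, (fun x : ℝ => 2 * x) u = 1 := by
    rw [integral_I_eq_intervalIntegral (fun x : ℝ => 2 * x),
      intervalIntegral.integral_const_mul, integral_id]
    norm_num
  unfold giniGamma at *
  rw [integral_congr_ae (Filter.Eventually.of_forall h), integral_sub hi integrable_copulaW_diag, h2]
  linarith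

theorem giniClass_nonempty {t : ℝ} (ht : t ∈ Icc (-1 : ℝ) 1) : (giniClass t).Nonempty := by
  obtain ⟨h0, h1⟩ := ht
  set a : ℝ := (1 + t) / 2 with ha
  have ha0 : 0 ≤ a := by linarith
  have ha1 : 0 ≤ 1 - a := by linarith
  have hM := isCopula_copulaM
  have hW := isCopula_copulaW
  refine ⟨fun u v => a * copulaM u v + (1 - a) * copulaW u v, ⟨⟨?_, ?_, ?_, ?_, ?_⟩, ?_⟩, ?_⟩
  · intro u v
    obtain ⟨m0, m1⟩ := hM.mem_Icc u v
    obtain ⟨w0, w1⟩ := hW.mem_Icc u v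
    exact ⟨by positivity, by nlinarith⟩
  · intro t; simp [hM.right_zero, hW.right_zero]
  · intro t; simp [hM.left_zero, hW.left_zero]
  · intro t; simp only [hM.right_one, hW.right_one]; ring
  · intro t; simp only [hM.left_one, hW.left_one]; ring
  · intro u₁ u₂ v₁ v₂ hu hv
    have := mul_nonneg ha0 (hM.two_increasing u₁ u₂ v₁ v₂ hu hv)
    have := mul_nonneg ha1 (hW.two_increasing u₁ u₂ v₁ v₂ hu hv)
    linarith
  · have e : ∀ u : I, (a * copulaM u u + (1 - a) * copulaW u u)
        + (a * copulaM u (σ u) + (1 - a) * copulaW u (σ u))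
        = a * (copulaM u u + copulaM u (σ u)) + (1 - a) * (copulaW u u + copulaW u (σ u)) :=
      fun u => by ring
    have gM := giniGamma_copulaM
    have gW := giniGamma_copulaW
    unfold giniGamma at *
    simp_rw [e]
    rw [integral_add (integrable_copulaM_diag.const_mul a)
      (integrable_copulaW_diag.const_mul (1 - a)), integral_const_mul, integral_const_mul]
    have : t = 2 * a - 1 := by rw [ha]; ring
    rw [this]
    linear_combination a * gM + (1 - a) * gW

theorem isGLB_giniInf {t : ℝ} (ht : t ∈ Icc (-1 : ℝ) 1) (u v : I) :
    IsGLB {x : ℝ | ∃ C ∈ giniClass t, C u v = x} (giniInf t u v) := by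
  obtain ⟨C, hC⟩ := giniClass_nonempty ht
  refine isGLB_csInf ⟨C u v, C, hC, rfl⟩ ⟨0, ?_⟩
  rintro x ⟨D, hD, rfl⟩
  exact (hD.1.mem_Icc u v).1

/-! Among the copulas with value d at (a, b) there is a largest one, `upperCopula`. Gini's gamma is
monotone in the copula, and mixing with W lowers gamma continuously to -1 without raising any value.
So `giniInf t a b` is the least d for which this largest copula has gamma at least t. Its diagonal
and antidiagonal sections are piecewise linear, and integrating them bounds gamma by a quadratic in
d (`IsCopula.giniGamma_le`). The lower root of that quadratic, `giniBound`, is a lower bound for the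
infimum, attained when two crossing points on the antidiagonal bracket the kinks.

For t ≤ 0 and a + b ≤ 1 the unbracketed cases have gamma at least 0, so they impose nothing;
survival copulas transfer this to a + b ≥ 1. Hence the infimum is max(W, `giniBound`). Put s = 1 - a
- b and δ = a - b. The mixed derivative of `giniBound` has the sign of (1 - t)/3 + s² - δ², while
`giniBound` > W forces δ² < (1 + 2t)/3. For t ≤ 0 the second bound implies nonnegativity of the
first, giving a copula. For 0 < t < 1 there is δ² strictly between (1 - t)/3 and (1 + 2t)/3, and a
small square centred there on the antidiagonal has negative volume. For t ≤ -1/2 nothing exceeds W;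
for t = 1 the loss on the diagonal forces M. -/

theorem integrable_of_continuous_unitInterval {f : I → ℝ} (hf : Continuous f) : Integrable f :=
  hf.integrable_of_hasCompactSupport (HasCompactSupport.of_compactSpace _)

/-! ### Elementary properties of copulas and symmetries of gamma -/

namespace IsCopula

variable {C : I → I → ℝ}

theorem mono_left (hC : IsCopula C) (v : I) {u₁ u₂ : I} (h : u₁ ≤ u₂) : C u₁ v ≤ C u₂ v := by
  have := hC.two_increasing u₁ u₂ 0 v h v.2.1
  rw [hC.right_zero, hC.right_zero] at this
  linarith

theorem mono_right (hC : IsCopula C) (u : I) {v₁ v₂ : I} (h : v₁ ≤ v₂) : C u v₁ ≤ C u v₂ := by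
  have := hC.two_increasing 0 u v₁ v₂ u.2.1 h
  rw [hC.left_zero, hC.left_zero] at this
  linarith

theorem sub_le_left (hC : IsCopula C) (v : I) {u₁ u₂ : I} (h : u₁ ≤ u₂) :
    C u₂ v - C u₁ v ≤ u₂ - u₁ := by
  have := hC.two_increasing u₁ u₂ v 1 h v.2.2
  rw [hC.right_one, hC.right_one] at this
  linarith

theorem sub_le_right (hC : IsCopula C) (u : I) {v₁ v₂ : I} (h : v₁ ≤ v₂) :
    C u v₂ - C u v₁ ≤ v₂ - v₁ := by
  have := hC.two_increasing u 1 v₁ v₂ u.2.2 h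
  rw [hC.left_one, hC.left_one] at this
  linarith

theorem sub_le_max_left (hC : IsCopula C) (u₁ u₂ v : I) :
    C u₂ v - C u₁ v ≤ max ((u₂ : ℝ) - u₁) 0 := by
  rcases le_total u₁ u₂ with h | h
  · exact (hC.sub_le_left v h).trans (le_max_left _ _)
  · exact (sub_nonpos.2 (hC.mono_left v h)).trans (le_max_right _ _)

theorem sub_le_max_right (hC : IsCopula C) (u v₁ v₂ : I) :
    C u v₂ - C u v₁ ≤ max ((v₂ : ℝ) - v₁) 0 := by
  rcases le_total v₁ v₂ with h | h
  · exact (hC.sub_le_right u h).trans (le_max_left _ _)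
  · exact (sub_nonpos.2 (hC.mono_right u h)).trans (le_max_right _ _)

theorem sub_le_abs_add_abs (hC : IsCopula C) (u₁ v₁ u₂ v₂ : I) :
    C u₁ v₁ - C u₂ v₂ ≤ |(u₁ : ℝ) - u₂| + |(v₁ : ℝ) - v₂| := by
  have h₁ := (hC.sub_le_max_left u₂ u₁ v₁).trans (max_le (le_abs_self _) (abs_nonneg _))
  have h₂ := (hC.sub_le_max_right u₂ v₂ v₁).trans (max_le (le_abs_self _) (abs_nonneg _))
  linarith

theorem le_copulaM (hC : IsCopula C) (u v : I) : C u v ≤ copulaM u v := by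
  have h₁ : C u v ≤ C u 1 := hC.mono_right u v.2.2
  have h₂ : C u v ≤ C 1 v := hC.mono_left v u.2.2
  rw [hC.right_one] at h₁
  rw [hC.left_one] at h₂
  exact le_min h₁ h₂

theorem copulaW_le (hC : IsCopula C) (u v : I) : copulaW u v ≤ C u v := by
  have h₁ : C u 1 - C u v ≤ ((1 : I) : ℝ) - v := hC.sub_le_right u v.2.2
  rw [hC.right_one] at h₁
  exact max_le (hC.mem_Icc u v).1 (by push_cast at h₁; linarith)

theorem continuous (hC : IsCopula C) : Continuous fun p : I × I => C p.1 p.2 := by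
  refine continuous_iff_continuousAt.2 fun p => ?_
  rw [ContinuousAt, tendsto_iff_dist_tendsto_zero]
  have hc : Continuous fun q : I × I => |(q.1 : ℝ) - p.1| + |(q.2 : ℝ) - p.2| := by fun_prop
  have h0 := hc.tendsto p
  simp only [sub_self, abs_zero, add_zero] at h0
  refine squeeze_zero (fun _ => dist_nonneg) (fun q => ?_) h0
  rw [Real.dist_eq]
  refine abs_le.2 ⟨?_, hC.sub_le_abs_add_abs _ _ _ _⟩
  have := hC.sub_le_abs_add_abs p.1 p.2 q.1 q.2
  rw [abs_sub_comm, abs_sub_comm (p.2 : ℝ)] at this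
  linarith

theorem continuous_diag (hC : IsCopula C) : Continuous fun u : I => C u u :=
  hC.continuous.comp (continuous_id.prodMk continuous_id)

theorem continuous_antidiag (hC : IsCopula C) : Continuous fun u : I => C u (σ u) :=
  hC.continuous.comp (continuous_id.prodMk unitInterval.continuous_symm)

theorem giniGamma_eq (hC : IsCopula C) :
    giniGamma C = 4 * ((∫ u : I, C u u) + ∫ u : I, C u (σ u)) - 2 := by
  rw [giniGamma, integral_add (integrable_of_continuous_unitInterval hC.continuous_diag)
    (integrable_of_continuous_unitInterval hC.continuous_antidiag)]

theorem convexCombination {D : I → I → ℝ} (hC : IsCopula C) (hD : IsCopula D) {r : ℝ}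
    (h₀ : 0 ≤ r) (h₁ : r ≤ 1) : IsCopula fun u v => r * C u v + (1 - r) * D u v where
  mem_Icc u v := by
    obtain ⟨c₀, c₁⟩ := hC.mem_Icc u v
    obtain ⟨d₀, d₁⟩ := hD.mem_Icc u v
    have h₂ : 0 ≤ 1 - r := sub_nonneg.2 h₁
    exact ⟨by positivity, by nlinarith⟩
  right_zero t := by simp [hC.right_zero, hD.right_zero]
  left_zero t := by simp [hC.left_zero, hD.left_zero]
  right_one t := by simp only [hC.right_one, hD.right_one]; ring
  left_one t := by simp only [hC.left_one, hD.left_one]; ring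
  two_increasing u₁ u₂ v₁ v₂ hu hv := by
    have := mul_nonneg h₀ (hC.two_increasing u₁ u₂ v₁ v₂ hu hv)
    have := mul_nonneg (sub_nonneg.2 h₁) (hD.two_increasing u₁ u₂ v₁ v₂ hu hv)
    linarith

theorem giniGamma_convexCombination {D : I → I → ℝ} (hC : IsCopula C) (hD : IsCopula D) (r : ℝ) :
    giniGamma (fun u v => r * C u v + (1 - r) * D u v)
      = r * giniGamma C + (1 - r) * giniGamma D := by
  have e : ∀ u : I, (r * C u u + (1 - r) * D u u) + (r * C u (σ u) + (1 - r) * D u (σ u))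
      = r * (C u u + C u (σ u)) + (1 - r) * (D u u + D u (σ u)) := fun u => by ring
  have iC : Integrable fun u : I => C u u + C u (σ u) :=
    integrable_of_continuous_unitInterval (hC.continuous_diag.add hC.continuous_antidiag)
  have iD : Integrable fun u : I => D u u + D u (σ u) :=
    integrable_of_continuous_unitInterval (hD.continuous_diag.add hD.continuous_antidiag)
  unfold giniGamma
  simp_rw [e]
  rw [integral_add (iC.const_mul r) (iD.const_mul (1 - r)), integral_const_mul, integral_const_mul]
  ring

/-- The survival copula. -/
theorem survival (hC : IsCopula C) : IsCopula fun u v => u + v - 1 + C (σ u) (σ v) where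
  mem_Icc u v := by
    have h := hC.copulaW_le (σ u) (σ v)
    have h' := (hC.le_copulaM (σ u) (σ v)).trans (min_le_left _ _)
    have h'' := (le_max_right _ _).trans h
    rw [unitInterval.coe_symm_eq, unitInterval.coe_symm_eq] at h''
    rw [unitInterval.coe_symm_eq] at h'
    have := v.2.2
    exact ⟨by linarith, by linarith⟩
  right_zero t := by simp [hC.right_one]
  left_zero t := by simp [hC.left_one]
  right_one t := by simp [hC.right_zero]
  left_one t := by simp [hC.left_zero]
  two_increasing u₁ u₂ v₁ v₂ hu hv := by
    have := hC.two_increasing (σ u₂) (σ u₁) (σ v₂) (σ v₁)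
      (unitInterval.symm_le_symm.2 hu) (unitInterval.symm_le_symm.2 hv)
    linarith

end IsCopula

theorem integral_symm_unitInterval (f : I → ℝ) : ∫ u : I, f (σ u) = ∫ u : I, f u :=
  unitInterval.measurePreserving_symm.integral_comp
    unitInterval.symmMeasurableEquiv.measurableEmbedding f

theorem integral_coe_unitInterval : ∫ u : I, (u : ℝ) = 1 / 2 := by
  rw [integral_I_eq_intervalIntegral (fun x => x), integral_id]
  norm_num

theorem integral_max_sub_zero {c : ℝ} (hc : c ∈ Icc (0 : ℝ) 1) :
    ∫ u : I, max ((u : ℝ) - c) 0 = (1 - c) ^ 2 / 2 := by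
  have hcont : Continuous (fun x : ℝ => max (x - c) 0) := by fun_prop
  rw [integral_I_eq_intervalIntegral (fun x : ℝ => max (x - c) 0),
    ← intervalIntegral.integral_add_adjacent_intervals (b := c)
      (hcont.intervalIntegrable _ _) (hcont.intervalIntegrable _ _)]
  have h1 : ∫ x in (0 : ℝ)..c, max (x - c) 0 = ∫ x in (0 : ℝ)..c, (0 : ℝ) := by
    refine intervalIntegral.integral_congr fun x hx => ?_
    rw [uIcc_of_le hc.1] at hx
    exact max_eq_right (by linarith [hx.2])
  have h2 : ∫ x in c..1, max (x - c) 0 = ∫ x in c..1, (x - c) := by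
    refine intervalIntegral.integral_congr fun x hx => ?_
    rw [uIcc_of_le hc.2] at hx
    exact max_eq_left (by linarith [hx.1])
  rw [h1, h2, intervalIntegral.integral_sub
    (Continuous.intervalIntegrable (by fun_prop) _ _)
    (Continuous.intervalIntegrable (by fun_prop) _ _), integral_id]
  simp
  ring

/-- Reflection in the centre preserves the diagonal and the antidiagonal, and the added term u + v -
1 integrates to zero on each. -/
theorem IsCopula.giniGamma_survival {C : I → I → ℝ} (hC : IsCopula C) :
    giniGamma (fun u v => u + v - 1 + C (σ u) (σ v)) = giniGamma C := by
  rw [hC.survival.giniGamma_eq, hC.giniGamma_eq]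
  have i₁ : Integrable fun u : I => C (σ u) (σ u) := integrable_of_continuous_unitInterval
    (hC.continuous_diag.comp unitInterval.continuous_symm)
  have i₂ : Integrable fun u : I => (u : ℝ) + u - 1 :=
    integrable_of_continuous_unitInterval (by fun_prop)
  have i₃ : Integrable fun u : I => (u : ℝ) :=
    integrable_of_continuous_unitInterval (by fun_prop)
  have e₁ : ∫ u : I, ((u : ℝ) + u - 1 + C (σ u) (σ u)) = ∫ u : I, C u u := by
    have i₄ : Integrable fun u : I => (u : ℝ) + u := i₃.add i₃
    rw [integral_add i₂ i₁, integral_symm_unitInterval fun u => C u u,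
      integral_sub i₄ (integrable_const _), integral_add i₃ i₃, integral_coe_unitInterval]
    simp; norm_num
  have e₂ : ∫ u : I, ((u : ℝ) + σ u - 1 + C (σ u) (σ (σ u))) = ∫ u : I, C u (σ u) := by
    rw [← integral_symm_unitInterval fun u => C u (σ u)]
    refine integral_congr_ae (Filter.Eventually.of_forall fun u => ?_)
    simp
  rw [e₁, e₂]

/-! ### The infimum: quasi-copula property and mixing with W -/

theorem giniInf_le {t : ℝ} {C : I → I → ℝ} (hC : C ∈ giniClass t) (u v : I) :
    giniInf t u v ≤ C u v :=
  csInf_le ⟨0, by rintro x ⟨D, hD, rfl⟩; exact (hD.1.mem_Icc u v).1⟩ ⟨C, hC, rfl⟩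

theorem le_giniInf {t : ℝ} (ht : t ∈ Icc (-1 : ℝ) 1) {u v : I} {x : ℝ}
    (h : ∀ C ∈ giniClass t, x ≤ C u v) : x ≤ giniInf t u v :=
  (isGLB_giniInf ht u v).2 (by rintro _ ⟨C, hC, rfl⟩; exact h C hC)

theorem isQuasiCopula_giniInf {t : ℝ} (ht : t ∈ Icc (-1 : ℝ) 1) : IsQuasiCopula (giniInf t) := by
  obtain ⟨C₀, hC₀⟩ := giniClass_nonempty ht
  have key : ∀ u v (x : ℝ), (∀ C, IsCopula C → C u v = x) → giniInf t u v = x := fun u v x h =>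
    le_antisymm ((giniInf_le hC₀ u v).trans_eq (h _ hC₀.1))
      (le_giniInf ht fun C hC => (h C hC.1).ge)
  have lip : ∀ u₁ v₁ u₂ v₂ : I,
      giniInf t u₁ v₁ - giniInf t u₂ v₂ ≤ |(u₁ : ℝ) - u₂| + |(v₁ : ℝ) - v₂| := fun u₁ v₁ u₂ v₂ => by
    rw [sub_le_comm]
    refine le_giniInf ht fun C hC => ?_
    have := hC.1.sub_le_abs_add_abs u₁ v₁ u₂ v₂
    have := giniInf_le hC u₁ v₁
    linarith
  refine ⟨⟨fun u v => ⟨le_giniInf ht fun C hC => (hC.1.mem_Icc u v).1,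
      (giniInf_le hC₀ u v).trans (hC₀.1.mem_Icc u v).2⟩,
    fun s => key _ _ _ fun C hC => hC.right_zero s, fun s => key _ _ _ fun C hC => hC.left_zero s,
    fun s => key _ _ _ fun C hC => hC.right_one s, fun s => key _ _ _ fun C hC => hC.left_one s⟩,
    fun v u₁ u₂ h => le_giniInf ht fun C hC => (giniInf_le hC _ _).trans (hC.1.mono_left v h),
    fun u v₁ v₂ h => le_giniInf ht fun C hC => (giniInf_le hC _ _).trans (hC.1.mono_right u h),
    fun u₁ v₁ u₂ v₂ => abs_le.2 ⟨?_, lip u₁ v₁ u₂ v₂⟩⟩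
  have := lip u₂ v₂ u₁ v₁
  rw [abs_sub_comm, abs_sub_comm (v₂ : ℝ)] at this
  linarith

theorem copulaW_le_giniInf {t : ℝ} (ht : t ∈ Icc (-1 : ℝ) 1) (u v : I) :
    copulaW u v ≤ giniInf t u v :=
  le_giniInf ht fun _ hC => hC.1.copulaW_le u v

/-- A copula with Gini's gamma at least `t` can be mixed with `W` to have Gini's gamma `t`. -/
theorem giniInf_le_of_le_giniGamma {t : ℝ} (ht : -1 ≤ t) {C : I → I → ℝ} (hC : IsCopula C)
    (h : t ≤ giniGamma C) (u v : I) : giniInf t u v ≤ C u v := by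
  rcases h.eq_or_lt with h | h
  · exact giniInf_le ⟨hC, h.symm⟩ u v
  have hpos : 0 < giniGamma C + 1 := by linarith
  -- Gamma of the mixture is affine in its weight r, from -1 at r = 0 to gamma of C at r = 1; this r
  -- gives t.
  set r := (t + 1) / (giniGamma C + 1) with hr
  have hr₀ : 0 ≤ r := div_nonneg (by linarith) hpos.le
  have hr₁ : r ≤ 1 := (div_le_one hpos).2 (by linarith)
  have hrm : r * (giniGamma C + 1) = t + 1 := div_mul_cancel₀ _ hpos.ne'
  refine (giniInf_le ⟨hC.convexCombination isCopula_copulaW hr₀ hr₁, ?_⟩ u v).trans ?_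
  · rw [hC.giniGamma_convexCombination isCopula_copulaW, giniGamma_copulaW]
    linarith
  · have := mul_le_mul_of_nonneg_left (hC.copulaW_le u v) (sub_nonneg.2 hr₁)
    linarith

theorem giniInf_le_of_survival {t : ℝ} (ht : -1 ≤ t) {C : I → I → ℝ} (hC : IsCopula C)
    (h : t ≤ giniGamma C) (u v : I) : giniInf t u v ≤ u + v - 1 + C (σ u) (σ v) :=
  giniInf_le_of_le_giniGamma ht hC.survival (hC.giniGamma_survival.symm ▸ h) u v

/-! ### The largest copula through a point, and its two sections -/

/-- The largest copula with value `d` at `(a, b)`. -/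
noncomputable def upperCopula (a b d : ℝ) (u v : I) : ℝ :=
  min (min (u : ℝ) v) (d + max ((u : ℝ) - a) 0 + max ((v : ℝ) - b) 0)

theorem isCopula_upperCopula {a b d : ℝ} (hd : 0 ≤ d)
    (hdW : a + b - 1 ≤ d) : IsCopula (upperCopula a b d) where
  mem_Icc u v := ⟨le_min (le_min u.2.1 v.2.1) (by positivity),
    (min_le_left _ _).trans ((min_le_left _ _).trans u.2.2)⟩
  right_zero t := by
    have : 0 ≤ d + max ((t : ℝ) - a) 0 + max (((0 : I) : ℝ) - b) 0 := by positivity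
    unfold upperCopula
    rw [min_eq_right (b := ((0 : I) : ℝ)) t.2.1]
    exact min_eq_left this
  left_zero t := by
    have : 0 ≤ d + max (((0 : I) : ℝ) - a) 0 + max ((t : ℝ) - b) 0 := by positivity
    unfold upperCopula
    rw [min_eq_left (a := ((0 : I) : ℝ)) t.2.1]
    exact min_eq_left this
  right_one t := by
    have h₁ := le_max_left ((t : ℝ) - a) 0
    have h₂ := le_max_left (((1 : I) : ℝ) - b) 0
    unfold upperCopula
    rw [min_eq_left (show (t : ℝ) ≤ (1 : I) from t.2.2)]
    refine min_eq_left ?_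
    push_cast at *
    linarith
  left_one t := by
    have h₁ := le_max_left (((1 : I) : ℝ) - a) 0
    have h₂ := le_max_left ((t : ℝ) - b) 0
    unfold upperCopula
    rw [min_eq_right (show (t : ℝ) ≤ (1 : I) from t.2.2)]
    refine min_eq_left ?_
    push_cast at *
    linarith
  two_increasing u₁ u₂ v₁ v₂ hu hv := by
    have hu' : (u₁ : ℝ) ≤ u₂ := hu
    have hv' : (v₁ : ℝ) ≤ v₂ := hv
    have x₁ : max ((u₁ : ℝ) - a) 0 ≤ max ((u₂ : ℝ) - a) 0 := max_le_max (by linarith) le_rfl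
    have y₁ : max ((v₁ : ℝ) - b) 0 ≤ max ((v₂ : ℝ) - b) 0 := max_le_max (by linarith) le_rfl
    have x₂ : max ((u₂ : ℝ) - a) 0 ≤ max ((u₁ : ℝ) - a) 0 + (u₂ - u₁) :=
      max_le (by linarith [le_max_left ((u₁ : ℝ) - a) 0])
        (by linarith [le_max_right ((u₁ : ℝ) - a) 0])
    have y₂ : max ((v₂ : ℝ) - b) 0 ≤ max ((v₁ : ℝ) - b) 0 + (v₂ - v₁) :=
      max_le (by linarith [le_max_left ((v₁ : ℝ) - b) 0])
        (by linarith [le_max_right ((v₁ : ℝ) - b) 0])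
    unfold upperCopula
    -- From here only monotonicity and the 1-Lipschitz bound of the positive parts matter. The cases
    -- fix the active terms at the two corners counted positively; at the other two every term is an
    -- upper bound.
    generalize max ((u₁ : ℝ) - a) 0 = X₁ at *
    generalize max ((u₂ : ℝ) - a) 0 = X₂ at *
    generalize max ((v₁ : ℝ) - b) 0 = Y₁ at *
    generalize max ((v₂ : ℝ) - b) 0 = Y₂ at *
    have p₁ := min_le_left (min (u₁ : ℝ) v₂) (d + X₁ + Y₂)
    have p₂ := min_le_right (min (u₁ : ℝ) v₂) (d + X₁ + Y₂)
    have p₃ := min_le_left (u₁ : ℝ) v₂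
    have p₄ := min_le_right (u₁ : ℝ) v₂
    have q₁ := min_le_left (min (u₂ : ℝ) v₁) (d + X₂ + Y₁)
    have q₂ := min_le_right (min (u₂ : ℝ) v₁) (d + X₂ + Y₁)
    have q₃ := min_le_left (u₂ : ℝ) v₁
    have q₄ := min_le_right (u₂ : ℝ) v₁
    rcases min_choice (min (u₂ : ℝ) v₂) (d + X₂ + Y₂) with h | h <;>
    rcases min_choice (min (u₁ : ℝ) v₁) (d + X₁ + Y₁) with h' | h' <;>
    rcases min_choice (u₂ : ℝ) v₂ with k | k <;>
    rcases min_choice (u₁ : ℝ) v₁ with k' | k' <;>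
    rw [h, h'] <;> linarith

theorem upperCopula_self {a b : I} {d : ℝ} (ha : d ≤ a) (hb : d ≤ b) :
    upperCopula a b d a b = d := by
  simp [upperCopula, ha, hb]

theorem IsCopula.le_upperCopula {C : I → I → ℝ} (hC : IsCopula C) (a b u v : I) :
    C u v ≤ upperCopula a b (C a b) u v := by
  refine le_min (hC.le_copulaM u v) ?_
  have h₁ := hC.sub_le_max_left a u v
  have h₂ := hC.sub_le_max_right a b v
  linarith

/-- The gap below M is a trapezoid: it rises from d to min(a, b), stays flat to max(a, b) and
returns to 0 at a + b - d. Its area is (a - d)(b - d). -/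
theorem upperCopula_diag {a b d u : ℝ} (ha : d ≤ a) (hb : d ≤ b) :
    min (min u u) (d + max (u - a) 0 + max (u - b) 0) =
      u - (max (u - d) 0 - max (u - a) 0 - max (u - b) 0 + max (u - (a + b - d)) 0) := by
  rw [min_self]
  rcases max_cases (u - a) 0 with h₁ | h₁ <;> rcases max_cases (u - b) 0 with h₂ | h₂ <;>
  rcases max_cases (u - d) 0 with h₃ | h₃ <;>
  rcases max_cases (u - (a + b - d)) 0 with h₄ | h₄ <;>
  rcases min_cases u (d + max (u - a) 0 + max (u - b) 0) with h₅ | h₅ <;> linarith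

theorem min_self_one_sub (u : ℝ) : min u (1 - u) = u - 2 * max (u - 1 / 2) 0 := by
  rcases max_cases (u - 1 / 2) 0 with h | h <;> rcases min_cases u (1 - u) with h' | h' <;> linarith

/-- The gap below `M` of the copula `upperCopula a b d` on the antidiagonal, up to positive parts. -/
noncomputable def antidiagGap (a b d u : ℝ) : ℝ :=
  2 * max (u - (1 - b + d) / 2) 0 + 2 * max (u - (1 + a - d) / 2) 0
    - 2 * max (u - 1 / 2) 0 - max (u - a) 0 - max (u - (1 - b)) 0

/-- The points (1 - b + d)/2 and (1 + a - d)/2 are where the lines d + 1 - b - u and d + u - a cross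
u and 1 - u. Between them `antidiagGap` is M minus the second term of the minimum; outside it is
nonpositive. -/
theorem upperCopula_antidiag_le {a b d u : ℝ} (ha : d ≤ a) (hb : d ≤ b) :
    min (min u (1 - u)) (d + max (u - a) 0 + max (1 - u - b) 0) ≤
      u - 2 * max (u - 1 / 2) 0 - antidiagGap a b d u := by
  rw [min_self_one_sub, antidiagGap]
  have hb' : max (1 - u - b) 0 = 1 - b - u + max (u - (1 - b)) 0 := by
    rcases max_cases (1 - u - b) 0 with h | h <;>
    rcases max_cases (u - (1 - b)) 0 with h' | h' <;> linarith
  rw [hb']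
  have n₁ := le_max_right (u - a) 0
  have n₂ := le_max_right (u - (1 - b)) 0
  have n₃ := le_max_right (u - 1 / 2) 0
  have m₁ := le_max_left (u - a) 0
  have m₂ := le_max_left (u - (1 - b)) 0
  have m₃ := le_max_left (u - 1 / 2) 0
  have p₁ := min_le_left (u - 2 * max (u - 1 / 2) 0)
    (d + max (u - a) 0 + (1 - b - u + max (u - (1 - b)) 0))
  have p₂ := min_le_right (u - 2 * max (u - 1 / 2) 0)
    (d + max (u - a) 0 + (1 - b - u + max (u - (1 - b)) 0))
  rcases max_cases (u - (1 - b + d) / 2) 0 with h₁ | h₁ <;>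
  rcases max_cases (u - (1 + a - d) / 2) 0 with h₂ | h₂ <;> linarith

/-- The four extra hypotheses place the kinks a and 1 - b between the two crossing points. Then
`antidiagGap` vanishes outside them and the preceding bound is an equality. -/
theorem le_upperCopula_antidiag {a b d u : ℝ} (ha : d ≤ a) (hb : d ≤ b)
    (h₁ : 1 + d ≤ 2 * a + b) (h₂ : 1 + d ≤ a + 2 * b) (h₃ : a + d ≤ 1) (h₄ : b + d ≤ 1) :
    u - 2 * max (u - 1 / 2) 0 - antidiagGap a b d u ≤
      min (min u (1 - u)) (d + max (u - a) 0 + max (1 - u - b) 0) := by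
  rw [min_self_one_sub, antidiagGap]
  have hb' : max (1 - u - b) 0 = 1 - b - u + max (u - (1 - b)) 0 := by
    rcases max_cases (1 - u - b) 0 with h | h <;>
    rcases max_cases (u - (1 - b)) 0 with h' | h' <;> linarith
  rw [hb']
  refine le_min ?_ ?_ <;>
  rcases max_cases (u - (1 - b + d) / 2) 0 with k₁ | k₁ <;>
  rcases max_cases (u - (1 + a - d) / 2) 0 with k₂ | k₂ <;>
  rcases max_cases (u - a) 0 with k₃ | k₃ <;>
  rcases max_cases (u - (1 - b)) 0 with k₄ | k₄ <;>
  rcases max_cases (u - 1 / 2) 0 with k₅ | k₅ <;> linarith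

/-- The left side is the truncated tent min(u, 1 - u, 1/2 - p), and the last term on the right is at
least d + 1 - a - b. This serves the cases where the kinks are not bracketed. -/
theorem tent_le_upperCopula_antidiag {a b d p u : ℝ} (hp : 0 ≤ p) (h : a + b - 1 / 2 - d ≤ p) :
    u - max (u - (1 / 2 - p)) 0 - max (u - (1 / 2 + p)) 0 ≤
      min (min u (1 - u)) (d + max (u - a) 0 + max (1 - u - b) 0) := by
  have n₁ := le_max_left (u - a) 0
  have n₂ := le_max_left (1 - u - b) 0
  refine le_min (le_min ?_ ?_) ?_ <;>
  rcases max_cases (u - (1 / 2 - p)) 0 with h₁ | h₁ <;>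
  rcases max_cases (u - (1 / 2 + p)) 0 with h₂ | h₂ <;> linarith

theorem integral_antidiagGap {a b d : ℝ} (ha : a ∈ Icc (0 : ℝ) 1) (hb : b ∈ Icc (0 : ℝ) 1)
    (h₀ : 0 ≤ d) (hda : d ≤ a) (hdb : d ≤ b) :
    ∫ u : I, antidiagGap a b d u = ((1 + b - d) ^ 2 + (1 - a + d) ^ 2) / 4
      - 1 / 4 - (1 - a) ^ 2 / 2 - b ^ 2 / 2 := by
  have i : ∀ c : ℝ, Integrable fun u : I => max ((u : ℝ) - c) 0 := fun c =>
    integrable_of_continuous_unitInterval (by fun_prop)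
  obtain ⟨a₀, a₁⟩ := ha
  obtain ⟨b₀, b₁⟩ := hb
  have e : ∀ f g : ℝ → ℝ, Continuous f → Continuous g →
      ∫ u : I, (f u - g u) = (∫ u : I, f u) - ∫ u : I, g u := fun f g hf hg =>
    integral_sub (integrable_of_continuous_unitInterval (hf.comp continuous_subtype_val))
      (integrable_of_continuous_unitInterval (hg.comp continuous_subtype_val))
  have h₁ := e (fun u => 2 * max (u - (1 - b + d) / 2) 0 + 2 * max (u - (1 + a - d) / 2) 0
    - 2 * max (u - 1 / 2) 0 - max (u - a) 0) (fun u => max (u - (1 - b)) 0)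
    (by fun_prop) (by fun_prop)
  have h₂ := e (fun u => 2 * max (u - (1 - b + d) / 2) 0 + 2 * max (u - (1 + a - d) / 2) 0
    - 2 * max (u - 1 / 2) 0) (fun u => max (u - a) 0) (by fun_prop) (by fun_prop)
  have h₃ := e (fun u => 2 * max (u - (1 - b + d) / 2) 0 + 2 * max (u - (1 + a - d) / 2) 0)
    (fun u => 2 * max (u - 1 / 2) 0) (by fun_prop) (by fun_prop)
  unfold antidiagGap
  rw [h₁, h₂, h₃, integral_add ((i _).const_mul 2) ((i _).const_mul 2),
    integral_const_mul, integral_const_mul, integral_const_mul,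
    integral_max_sub_zero ⟨by linarith, by linarith⟩, integral_max_sub_zero ⟨by linarith, by linarith⟩,
    integral_max_sub_zero ⟨by linarith, by linarith⟩, integral_max_sub_zero ⟨by linarith, by linarith⟩,
    integral_max_sub_zero ⟨by linarith, by linarith⟩]
  ring

theorem integral_diagGap {a b d : ℝ} (ha : a ≤ 1) (hb : b ≤ 1)
    (h₀ : 0 ≤ d) (hda : d ≤ a) (hdb : d ≤ b) (hdW : a + b - 1 ≤ d) :
    ∫ u : I, (u - (max ((u : ℝ) - d) 0 - max ((u : ℝ) - a) 0 - max ((u : ℝ) - b) 0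
      + max ((u : ℝ) - (a + b - d)) 0)) = 1 / 2 - (a - d) * (b - d) := by
  have i : ∀ c : ℝ, Integrable fun u : I => max ((u : ℝ) - c) 0 := fun c =>
    integrable_of_continuous_unitInterval (by fun_prop)
  have i₃ : Integrable fun u : I => (u : ℝ) :=
    integrable_of_continuous_unitInterval (by fun_prop)
  have i₄ : Integrable fun u : I => max ((u : ℝ) - d) 0 - max ((u : ℝ) - a) 0
      - max ((u : ℝ) - b) 0 + max ((u : ℝ) - (a + b - d)) 0 :=
    integrable_of_continuous_unitInterval (by fun_prop)
  have i₅ : Integrable fun u : I => max ((u : ℝ) - d) 0 - max ((u : ℝ) - a) 0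
      - max ((u : ℝ) - b) 0 := integrable_of_continuous_unitInterval (by fun_prop)
  have i₆ : Integrable fun u : I => max ((u : ℝ) - d) 0 - max ((u : ℝ) - a) 0 :=
    integrable_of_continuous_unitInterval (by fun_prop)
  rw [integral_sub i₃ i₄, integral_add i₅ (i _),
    integral_sub i₆ (i _), integral_sub (i _) (i _),
    integral_max_sub_zero ⟨by linarith, by linarith⟩, integral_max_sub_zero ⟨by linarith, by linarith⟩,
    integral_max_sub_zero ⟨by linarith, by linarith⟩, integral_max_sub_zero ⟨by linarith, by linarith⟩,
    integral_coe_unitInterval]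
  ring

theorem integral_tent {p : ℝ} (h₀ : 0 ≤ p) (h₁ : p ≤ 1 / 2) :
    ∫ u : I, (u - max ((u : ℝ) - (1 / 2 - p)) 0 - max ((u : ℝ) - (1 / 2 + p)) 0)
      = 1 / 4 - p ^ 2 := by
  have i : ∀ c : ℝ, Integrable fun u : I => max ((u : ℝ) - c) 0 := fun c =>
    integrable_of_continuous_unitInterval (by fun_prop)
  have i₃ : Integrable fun u : I => (u : ℝ) :=
    integrable_of_continuous_unitInterval (by fun_prop)
  have i₄ : Integrable fun u : I => (u : ℝ) - max ((u : ℝ) - (1 / 2 - p)) 0 :=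
    integrable_of_continuous_unitInterval (by fun_prop)
  rw [integral_sub i₄ (i _), integral_sub i₃ (i _),
    integral_max_sub_zero ⟨by linarith, by linarith⟩,
    integral_max_sub_zero ⟨by linarith, by linarith⟩, integral_coe_unitInterval]
  ring

theorem integral_sub_antidiagGap {a b d : ℝ} (ha : a ∈ Icc (0 : ℝ) 1) (hb : b ∈ Icc (0 : ℝ) 1)
    (h₀ : 0 ≤ d) (hda : d ≤ a) (hdb : d ≤ b) :
    ∫ u : I, (u - 2 * max ((u : ℝ) - 1 / 2) 0 - antidiagGap a b d u) =
      1 / 4 + (a - d) * (b - d) - (3 / 2 * ((a - d) * (b - d)) - (1 - a - b) ^ 2 / 4) := by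
  have i₁ : Integrable fun u : I => (u : ℝ) :=
    integrable_of_continuous_unitInterval (by fun_prop)
  have i₂ : Integrable fun u : I => 2 * max ((u : ℝ) - 1 / 2) 0 :=
    integrable_of_continuous_unitInterval (by fun_prop)
  have i₃ : Integrable fun u : I => antidiagGap a b d u :=
    integrable_of_continuous_unitInterval (by unfold antidiagGap; fun_prop)
  have i₄ : Integrable fun u : I => (u : ℝ) - 2 * max ((u : ℝ) - 1 / 2) 0 :=
    integrable_of_continuous_unitInterval (by fun_prop)
  rw [integral_sub i₄ i₃, integral_sub i₁ i₂, integral_const_mul,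
    integral_max_sub_zero ⟨by norm_num, by norm_num⟩, integral_coe_unitInterval,
    integral_antidiagGap ha hb h₀ hda hdb]
  ring

/-! ### Bounds for gamma given one value of the copula -/

/-- The Fréchet-Hoeffding bounds at a point, written out as inequalities. -/
theorem IsCopula.bounds {C : I → I → ℝ} (hC : IsCopula C) (a b : I) :
    0 ≤ C a b ∧ C a b ≤ a ∧ C a b ≤ b ∧ (a : ℝ) + b - 1 ≤ C a b :=
  ⟨(hC.mem_Icc a b).1, (hC.le_copulaM a b).trans (min_le_left _ _),
    (hC.le_copulaM a b).trans (min_le_right _ _), (le_max_right _ _).trans (hC.copulaW_le a b)⟩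

theorem IsCopula.integral_diag_le {C : I → I → ℝ} (hC : IsCopula C) (a b : I) :
    ∫ u : I, C u u ≤ 1 / 2 - (a - C a b) * (b - C a b) := by
  obtain ⟨h₀, hda, hdb, hdW⟩ := hC.bounds a b
  rw [← integral_diagGap a.2.2 b.2.2 h₀ hda hdb hdW]
  exact integral_mono (integrable_of_continuous_unitInterval hC.continuous_diag)
    (integrable_of_continuous_unitInterval (by fun_prop))
    (fun u => (hC.le_upperCopula a b u u).trans_eq (upperCopula_diag hda hdb))

theorem IsCopula.giniGamma_le {C : I → I → ℝ} (hC : IsCopula C) (a b : I) :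
    giniGamma C ≤ 1 - 4 * (3 / 2 * ((a - C a b) * (b - C a b)) - (1 - a - b) ^ 2 / 4) := by
  obtain ⟨h₀, hda, hdb, -⟩ := hC.bounds a b
  have hdiag := hC.integral_diag_le a b
  have hanti := integral_mono (integrable_of_continuous_unitInterval hC.continuous_antidiag)
    (integrable_of_continuous_unitInterval (by unfold antidiagGap; fun_prop))
    (fun u => (hC.le_upperCopula a b u (σ u)).trans (upperCopula_antidiag_le hda hdb))
  rw [integral_sub_antidiagGap a.2 b.2 h₀ hda hdb] at hanti
  rw [hC.giniGamma_eq]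
  linarith

/-- Only the diagonal loss is counted, the antidiagonal being bounded by that of M. Without the (1 -
a - b)² term of `IsCopula.giniGamma_le`, gamma = 1 forces C(a, a) = a. -/
theorem IsCopula.giniGamma_le_of_diag {C : I → I → ℝ} (hC : IsCopula C) (a b : I) :
    giniGamma C ≤ 1 - 4 * ((a - C a b) * (b - C a b)) := by
  have hdiag := hC.integral_diag_le a b
  have hanti := integral_mono (integrable_of_continuous_unitInterval hC.continuous_antidiag)
    (integrable_of_continuous_unitInterval isCopula_copulaM.continuous_antidiag)
    (fun u => hC.le_copulaM u (σ u))
  have hM : ∫ u : I, copulaM u u = 1 / 2 := by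
    simp only [copulaM, min_self, integral_coe_unitInterval]
  have := isCopula_copulaM.giniGamma_eq
  rw [giniGamma_copulaM] at this
  rw [hC.giniGamma_eq]
  linarith

section upperCopula

variable {a b d : ℝ}

theorem giniGamma_upperCopula_eq (ha : a ≤ 1) (hb : b ≤ 1) (h₀ : 0 ≤ d) (hda : d ≤ a)
    (hdb : d ≤ b) (hdW : a + b - 1 ≤ d) :
    giniGamma (upperCopula a b d) =
      4 * (1 / 2 - (a - d) * (b - d) + ∫ u : I, upperCopula a b d u (σ u)) - 2 := by
  rw [(isCopula_upperCopula h₀ hdW).giniGamma_eq, ← integral_diagGap ha hb h₀ hda hdb hdW]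
  congr 3
  exact integral_congr_ae (Filter.Eventually.of_forall fun u => upperCopula_diag hda hdb)

theorem le_giniGamma_upperCopula (ha : a ≤ 1) (hb : b ≤ 1) (h₀ : 0 ≤ d) (hda : d ≤ a)
    (hdb : d ≤ b) (hdW : a + b - 1 ≤ d) (h₁ : 1 + d ≤ 2 * a + b) (h₂ : 1 + d ≤ a + 2 * b)
    (h₃ : a + d ≤ 1) (h₄ : b + d ≤ 1) :
    1 - 4 * (3 / 2 * ((a - d) * (b - d)) - (1 - a - b) ^ 2 / 4) ≤
      giniGamma (upperCopula a b d) := by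
  have hC := isCopula_upperCopula h₀ hdW
  have hanti := integral_mono (f := fun u : I => (u : ℝ) - 2 * max ((u : ℝ) - 1 / 2) 0
      - antidiagGap a b d u)
    (integrable_of_continuous_unitInterval (by unfold antidiagGap; fun_prop))
    (integrable_of_continuous_unitInterval hC.continuous_antidiag)
    (fun u => le_upperCopula_antidiag hda hdb h₁ h₂ h₃ h₄)
  rw [integral_sub_antidiagGap ⟨h₀.trans hda, ha⟩ ⟨h₀.trans hdb, hb⟩ h₀ hda hdb] at hanti
  rw [giniGamma_upperCopula_eq ha hb h₀ hda hdb hdW]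
  linarith

theorem zero_le_giniGamma_upperCopula (ha : a ≤ 1) (hb : b ≤ 1) (h₀ : 0 ≤ d) (hda : d ≤ a)
    (hdb : d ≤ b) (hab : a + b ≤ 1) (h : 2 * a + b ≤ 1 + d ∨ a + 2 * b ≤ 1 + d) :
    0 ≤ giniGamma (upperCopula a b d) := by
  have hdW : a + b - 1 ≤ d := by linarith
  have hC := isCopula_upperCopula h₀ hdW
  have hp₀ : 0 ≤ max (a + b - 1 / 2 - d) 0 := le_max_right _ _
  have hanti := integral_mono (f := fun u : I => (u : ℝ)
      - max ((u : ℝ) - (1 / 2 - max (a + b - 1 / 2 - d) 0)) 0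
      - max ((u : ℝ) - (1 / 2 + max (a + b - 1 / 2 - d) 0)) 0)
    (integrable_of_continuous_unitInterval (by fun_prop))
    (integrable_of_continuous_unitInterval hC.continuous_antidiag)
    (fun u => tent_le_upperCopula_antidiag hp₀ (le_max_left _ _))
  rw [integral_tent hp₀ (max_le (by linarith) (by norm_num))] at hanti
  rw [giniGamma_upperCopula_eq ha hb h₀ hda hdb hdW]
  suffices (a - d) * (b - d) + max (a + b - 1 / 2 - d) 0 ^ 2 ≤ 1 / 4 by linarith
  obtain ⟨x, rfl⟩ : ∃ x, a = d + x := ⟨a - d, by ring⟩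
  obtain ⟨y, rfl⟩ : ∃ y, b = d + y := ⟨b - d, by ring⟩
  have hx : 0 ≤ x := by linarith
  have hy : 0 ≤ y := by linarith
  -- Let p be the maximum. If p > 0 and 2a + b ≤ 1 + d, then p ≤ y/2 and x ≤ (1 - y)/2, so xy + p² ≤
  -- 1/4 - (1 - y)²/4; the other alternative is symmetric. If p = 0, use x + y ≤ 1 and AM-GM.
  rcases max_cases (d + x + (d + y) - 1 / 2 - d) 0 with ⟨e, k⟩ | ⟨e, k⟩ <;> rw [e]
  · rcases h with h | h
    · have k₁ : d + x + (d + y) - 1 / 2 - d ≤ y / 2 := by linarith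
      have k₂ := mul_self_le_mul_self k k₁
      have k₃ := mul_le_mul_of_nonneg_right (show x ≤ (1 - y) / 2 by linarith) hy
      nlinarith [sq_nonneg (1 - y)]
    · have k₁ : d + x + (d + y) - 1 / 2 - d ≤ x / 2 := by linarith
      have k₂ := mul_self_le_mul_self k k₁
      have k₃ := mul_le_mul_of_nonneg_left (show y ≤ (1 - x) / 2 by linarith) hx
      nlinarith [sq_nonneg (1 - x)]
  · nlinarith [sq_nonneg (x - y)]

end upperCopula

/-! ### Closed form of the infimum for t ≤ 0 -/

/-- The radicand in the closed form of the lower bound `giniBound`. -/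
noncomputable def giniRadicand (t a b : ℝ) : ℝ :=
  (1 - t) / 6 + (1 - a - b) ^ 2 / 6 + (a - b) ^ 2 / 4

/-- The lower bound at `(a, b)` for copulas with Gini's gamma `t`, wherever it exceeds `W`. -/
noncomputable def giniBound (t a b : ℝ) : ℝ := (a + b) / 2 - √(giniRadicand t a b)

section giniBound

variable {t a b d : ℝ}

/-- Since (a - d)(b - d) = ((a + b)/2 - d)² - (a - b)²/4, the right side says ((a + b)/2 - d)² ≤
`giniRadicand`; d ≤ a and d ≤ b select the lower root. -/
theorem giniBound_le_iff (ht : t ≤ 1) (ha : d ≤ a) (hb : d ≤ b) :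
    giniBound t a b ≤ d ↔
      t ≤ 1 - 4 * (3 / 2 * ((a - d) * (b - d)) - (1 - a - b) ^ 2 / 4) := by
  have : 0 ≤ giniRadicand t a b := by
    have : 0 ≤ (1 - t) / 6 := by linarith
    unfold giniRadicand
    positivity
  rw [giniBound, sub_le_comm, Real.le_sqrt (by linarith) this, giniRadicand]
  constructor <;> intro h <;> nlinarith

theorem giniBound_swap : giniBound t a b = giniBound t b a := by
  unfold giniBound giniRadicand
  ring_nf

theorem giniBound_one_sub : giniBound t (1 - a) (1 - b) = giniBound t a b + 1 - a - b := by
  have : giniRadicand t (1 - a) (1 - b) = giniRadicand t a b := by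
    unfold giniRadicand; ring
  rw [giniBound, this, giniBound]
  ring

theorem giniBound_le_right (ht : t ≤ 1) : giniBound t a b ≤ b := by
  have : (a - b) / 2 ≤ √(giniRadicand t a b) := by
    apply Real.le_sqrt_of_sq_le
    unfold giniRadicand
    nlinarith [sq_nonneg (1 - a - b)]
  unfold giniBound
  linarith

theorem giniBound_le_left (ht : t ≤ 1) : giniBound t a b ≤ a :=
  giniBound_swap.trans_le (giniBound_le_right ht)

end giniBound

theorem giniBound_le_giniInf {t : ℝ} (ht : t ∈ Icc (-1 : ℝ) 1) (a b : I) :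
    giniBound t a b ≤ giniInf t a b := by
  refine le_giniInf ht fun C hC => ?_
  obtain ⟨-, hda, hdb, -⟩ := hC.1.bounds a b
  rw [giniBound_le_iff ht.2 hda hdb, ← hC.2]
  exact hC.1.giniGamma_le a b

theorem giniInf_le_of_le_giniGamma_upperCopula {t : ℝ} (ht : -1 ≤ t) {a b : I} {d : ℝ}
    (h₀ : 0 ≤ d) (hda : d ≤ a) (hdb : d ≤ b) (hab : (a : ℝ) + b ≤ 1)
    (h : t ≤ giniGamma (upperCopula a b d)) :
    giniInf t a b ≤ d ∧ giniInf t (σ a) (σ b) ≤ 1 - a - b + d := by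
  have hC := isCopula_upperCopula h₀ (show (a : ℝ) + b - 1 ≤ d by linarith)
  have h₁ := giniInf_le_of_le_giniGamma ht hC h a b
  have h₂ := giniInf_le_of_survival ht hC h (σ a) (σ b)
  rw [unitInterval.symm_symm, unitInterval.symm_symm, unitInterval.coe_symm_eq,
    unitInterval.coe_symm_eq] at h₂
  rw [upperCopula_self hda hdb] at h₁ h₂
  exact ⟨h₁, by linarith⟩

theorem giniInf_le_of_giniBound_le {t : ℝ} (ht : t ∈ Icc (-1 : ℝ) 1) {a b : I} {d : ℝ}
    (h₀ : 0 ≤ d) (hda : d ≤ a) (hdb : d ≤ b) (hab : (a : ℝ) + b ≤ 1)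
    (h₁ : 1 + d ≤ 2 * a + b) (h₂ : 1 + d ≤ a + 2 * b) (h : giniBound t a b ≤ d) :
    giniInf t a b ≤ d ∧ giniInf t (σ a) (σ b) ≤ 1 - a - b + d :=
  giniInf_le_of_le_giniGamma_upperCopula ht.1 h₀ hda hdb hab <|
    ((giniBound_le_iff ht.2 hda hdb).1 h).trans <|
    le_giniGamma_upperCopula a.2.2 b.2.2 h₀ hda hdb (by linarith) h₁ h₂ (by linarith) (by linarith)

theorem giniInf_le_of_nonpos {t : ℝ} (ht : t ∈ Icc (-1 : ℝ) 0) {a b : I} (hab : (a : ℝ) + b ≤ 1) :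
    giniInf t a b ≤ max 0 (giniBound t a b) ∧
      giniInf t (σ a) (σ b) ≤ 1 - a - b + max 0 (giniBound t a b) := by
  have ht₁ : t ≤ 1 := ht.2.trans zero_le_one
  have h₀ : 0 ≤ max 0 (giniBound t a b) := le_max_left _ _
  have hda : max 0 (giniBound t a b) ≤ a := max_le a.2.1 (giniBound_le_left ht₁)
  have hdb : max 0 (giniBound t a b) ≤ b := max_le b.2.1 (giniBound_le_right ht₁)
  by_cases h : 1 + max 0 (giniBound t a b) ≤ 2 * a + b ∧ 1 + max 0 (giniBound t a b) ≤ a + 2 * b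
  · exact giniInf_le_of_giniBound_le ⟨ht.1, ht₁⟩ h₀ hda hdb hab h.1 h.2 (le_max_right _ _)
  -- Here t ≤ 0 enters: with unbracketed kinks gamma is only known to be nonnegative.
  · refine giniInf_le_of_le_giniGamma_upperCopula ht.1 h₀ hda hdb hab <|
      ht.2.trans (zero_le_giniGamma_upperCopula a.2.2 b.2.2 h₀ hda hdb hab ?_)
    rw [not_and_or, not_le, not_le] at h
    exact h.imp le_of_lt le_of_lt

theorem giniInf_eq_of_nonpos {t : ℝ} (ht : t ∈ Icc (-1 : ℝ) 0) (a b : I) :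
    giniInf t a b = max (copulaW a b) (giniBound t a b) := by
  have ht₁ : t ∈ Icc (-1 : ℝ) 1 := ⟨ht.1, ht.2.trans zero_le_one⟩
  refine le_antisymm ?_ (max_le (copulaW_le_giniInf ht₁ a b) (giniBound_le_giniInf ht₁ a b))
  rcases le_total ((a : ℝ) + b) 1 with h | h
  · exact (giniInf_le_of_nonpos ht h).1.trans (max_le_max (le_max_left _ _) le_rfl)
  · have h₂ := (giniInf_le_of_nonpos (a := σ a) (b := σ b) ht (by
      rw [unitInterval.coe_symm_eq, unitInterval.coe_symm_eq]; linarith)).2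
    rw [unitInterval.symm_symm, unitInterval.symm_symm, unitInterval.coe_symm_eq,
      unitInterval.coe_symm_eq, giniBound_one_sub] at h₂
    refine h₂.trans ?_
    have h₃ : (a : ℝ) + b - 1 ≤ copulaW a b := le_max_right _ _
    rcases max_choice 0 (giniBound t a b + 1 - a - b) with e | e <;> rw [e]
    · exact le_max_of_le_left (by linarith)
    · exact le_max_of_le_right (by linarith)

/-! ### Monotonicity and 2-increasingness for t ≤ 0 -/

section derivatives

variable {t : ℝ}

theorem giniRadicand_pos (ht : t < 1) (a b : ℝ) : 0 < giniRadicand t a b := by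
  have : 0 < (1 - t) / 6 := by linarith
  unfold giniRadicand
  positivity

theorem hasDerivAt_giniRadicand_left (a b : ℝ) :
    HasDerivAt (fun x => giniRadicand t x b) ((5 * a - b - 2) / 6) a := by
  have h₁ := (((hasDerivAt_id a).const_sub 1).sub_const b).pow 2
  have h₂ := ((hasDerivAt_id a).sub_const b).pow 2
  have h₃ := ((h₁.div_const 6).const_add ((1 - t) / 6)).add (h₂.div_const 4)
  refine h₃.congr_deriv ?_
  simp only [id]
  ring

theorem hasDerivAt_giniRadicand_right (a b : ℝ) :
    HasDerivAt (fun y => giniRadicand t a y) ((5 * b - a - 2) / 6) b := by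
  have : (fun y => giniRadicand t a y) = fun y => giniRadicand t y a := by
    funext y; unfold giniRadicand; ring
  rw [this]
  exact hasDerivAt_giniRadicand_left b a

theorem hasDerivAt_sqrt_giniRadicand (ht : t < 1) (a b : ℝ) :
    HasDerivAt (fun x => √(giniRadicand t x b))
      ((5 * a - b - 2) / 6 / (2 * √(giniRadicand t a b))) a :=
  (hasDerivAt_giniRadicand_left a b).sqrt (giniRadicand_pos ht a b).ne'

/-- Equivalently, the partial derivative of `giniBound` lies in [0, 1]. -/
theorem abs_deriv_le (ht : t ≤ 0) {a b : ℝ} (ha : a ∈ Icc (0 : ℝ) 1) (hb : b ∈ Icc (0 : ℝ) 1) :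
    |(5 * a - b - 2) / 6 / (2 * √(giniRadicand t a b))| ≤ 1 / 2 := by
  have hpos := Real.sqrt_pos.2 (giniRadicand_pos (ht.trans_lt one_pos) a b)
  rw [abs_div, abs_of_pos (mul_pos two_pos hpos), div_le_iff₀ (by positivity)]
  have : |(5 * a - b - 2) / 6| ≤ √(giniRadicand t a b) := by
    apply Real.abs_le_sqrt
    unfold giniRadicand
    obtain ⟨a₀, a₁⟩ := ha
    obtain ⟨b₀, b₁⟩ := hb
    nlinarith [mul_nonneg a₀ b₀, mul_nonneg (sub_nonneg.2 a₁) (sub_nonneg.2 b₁),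
      mul_nonneg a₀ (sub_nonneg.2 b₁), mul_nonneg b₀ (sub_nonneg.2 a₁),
      mul_nonneg a₀ (sub_nonneg.2 a₁), mul_nonneg b₀ (sub_nonneg.2 b₁)]
  linarith

theorem giniBound_mono_and_lipschitz_left (ht : t ≤ 0) {a₁ a₂ b : ℝ} (ha₁ : 0 ≤ a₁) (ha : a₁ ≤ a₂)
    (ha₂ : a₂ ≤ 1) (hb : b ∈ Icc (0 : ℝ) 1) :
    giniBound t a₁ b ≤ giniBound t a₂ b ∧ giniBound t a₂ b - giniBound t a₁ b ≤ a₂ - a₁ := by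
  have h := (convex_Icc (0 : ℝ) 1).norm_image_sub_le_of_norm_hasDerivWithin_le
    (f := fun x => √(giniRadicand t x b)) (C := 1 / 2)
    (fun x _ => (hasDerivAt_sqrt_giniRadicand (ht.trans_lt one_pos) x b).hasDerivWithinAt)
    (fun x hx => abs_deriv_le ht hx hb) ⟨ha₁, ha.trans ha₂⟩ ⟨ha₁.trans ha, ha₂⟩
  rw [Real.norm_eq_abs, Real.norm_eq_abs, abs_of_nonneg (sub_nonneg.2 ha), abs_le] at h
  unfold giniBound
  constructor <;> linarith [h.1, h.2]

theorem giniBound_mono_and_lipschitz_right (ht : t ≤ 0) {a b₁ b₂ : ℝ} (hb₁ : 0 ≤ b₁) (hb : b₁ ≤ b₂)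
    (hb₂ : b₂ ≤ 1) (ha : a ∈ Icc (0 : ℝ) 1) :
    giniBound t a b₁ ≤ giniBound t a b₂ ∧ giniBound t a b₂ - giniBound t a b₁ ≤ b₂ - b₁ := by
  rw [giniBound_swap (a := a), giniBound_swap (a := a)]
  exact giniBound_mono_and_lipschitz_left ht hb₁ hb hb₂ ha

theorem deriv_sqrt_giniRadicand_antitone (ht : t < 1) {a b₁ b₂ r : ℝ} (hr : r ^ 2 ≤ (1 - t) / 3)
    (hb : b₁ ≤ b₂) (h₁ : a - b₁ ≤ r) (h₂ : b₂ - a ≤ r) :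
    (5 * a - b₂ - 2) / 6 / (2 * √(giniRadicand t a b₂)) ≤
      (5 * a - b₁ - 2) / 6 / (2 * √(giniRadicand t a b₁)) := by
  have hd : ∀ b, HasDerivAt (fun b => (5 * a - b - 2) / 6 / (2 * √(giniRadicand t a b)))
      ((-1 / 6 * (2 * √(giniRadicand t a b)) - (5 * a - b - 2) / 6 *
        (2 * ((5 * b - a - 2) / 6 / (2 * √(giniRadicand t a b))))) /
        (2 * √(giniRadicand t a b)) ^ 2) b := fun b => by
    have hpos := Real.sqrt_pos.2 (giniRadicand_pos ht a b)
    exact ((((hasDerivAt_id b).const_sub (5 * a)).sub_const 2).div_const 6).div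
      (((hasDerivAt_giniRadicand_right a b).sqrt (giniRadicand_pos ht a b).ne').const_mul 2)
      (by positivity)
  refine antitoneOn_of_deriv_nonpos (convex_Icc b₁ b₂)
    (fun b _ => (hd b).continuousAt.continuousWithinAt)
    (fun b _ => (hd b).differentiableAt.differentiableWithinAt) (fun b hb' => ?_)
    (left_mem_Icc.2 hb) (right_mem_Icc.2 hb) hb
  rw [interior_Icc] at hb'
  rw [(hd b).deriv]
  have hpos := Real.sqrt_pos.2 (giniRadicand_pos ht a b)
  have hsq := Real.sq_sqrt (giniRadicand_pos ht a b).le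
  refine div_nonpos_of_nonpos_of_nonneg ?_ (by positivity)
  have hδ : (a - b) ^ 2 ≤ (1 - t) / 3 :=
    (sq_le_sq' (by linarith [hb'.2]) (by linarith [hb'.1])).trans hr
  have e : -1 / 6 * (2 * √(giniRadicand t a b)) - (5 * a - b - 2) / 6 *
        (2 * ((5 * b - a - 2) / 6 / (2 * √(giniRadicand t a b)))) =
      -(√(giniRadicand t a b) ^ 2 / 3 + (5 * a - b - 2) / 6 * ((5 * b - a - 2) / 6)) /
        √(giniRadicand t a b) := by
    field_simp
    ring
  rw [e, hsq]
  refine div_nonpos_of_nonpos_of_nonneg ?_ hpos.le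
  unfold giniRadicand
  -- The expression in parentheses in `e` equals (1 - t)/18 + ((1 - a - b)² - (a - b)²)/6.
  nlinarith [sq_nonneg (1 - a - b)]

/-- On a rectangle a - b is extremal at (a₂, b₁) and (a₁, b₂), so control there makes the mixed
derivative nonnegative throughout. -/
theorem giniBound_two_increasing (ht : t < 1) {a₁ a₂ b₁ b₂ r : ℝ} (hr : r ^ 2 ≤ (1 - t) / 3)
    (ha : a₁ ≤ a₂) (hb : b₁ ≤ b₂) (h₁ : a₂ - b₁ ≤ r) (h₂ : b₂ - a₁ ≤ r) :
    0 ≤ giniBound t a₂ b₂ - giniBound t a₂ b₁ - giniBound t a₁ b₂ + giniBound t a₁ b₁ := by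
  have hd : ∀ a, HasDerivAt (fun a => √(giniRadicand t a b₁) - √(giniRadicand t a b₂)) _ a :=
    fun a => (hasDerivAt_sqrt_giniRadicand ht a b₁).sub (hasDerivAt_sqrt_giniRadicand ht a b₂)
  have h := monotoneOn_of_deriv_nonneg (convex_Icc a₁ a₂)
    (fun a _ => (hd a).continuousAt.continuousWithinAt)
    (fun a _ => (hd a).differentiableAt.differentiableWithinAt) (fun a ha' => by
      rw [interior_Icc] at ha'
      rw [(hd a).deriv]
      exact sub_nonneg.2 (deriv_sqrt_giniRadicand_antitone ht hr hb (by linarith [ha'.2])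
        (by linarith [ha'.1])))
    (left_mem_Icc.2 ha) (right_mem_Icc.2 ha) ha
  dsimp only at h
  unfold giniBound
  linarith

/-- Exceeding both terms of W puts the radicand below 1/4, so (a - b)² < (1 + 2t)/3, which is at
most (1 - t)/3 when t ≤ 0. -/
theorem sq_sub_le_of_copulaW_lt_giniBound (ht : t ≤ 0) {a b : I}
    (h : copulaW a b < giniBound t a b) : ((a : ℝ) - b) ^ 2 ≤ (1 - t) / 3 := by
  have h₁ : √(giniRadicand t a b) < ((a : ℝ) + b) / 2 := by
    have := (le_max_left _ _).trans_lt h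
    unfold giniBound at this
    linarith
  have h₂ : √(giniRadicand t a b) < 1 - ((a : ℝ) + b) / 2 := by
    have := (le_max_right _ _).trans_lt h
    unfold giniBound at this
    linarith
  have h₃ : √(giniRadicand t a b) < 1 / 2 := by linarith
  rw [Real.sqrt_lt' (by norm_num), giniRadicand] at h₃
  nlinarith [sq_nonneg (1 - (a : ℝ) - b)]

end derivatives

theorem isCopula_giniInf_of_nonpos {t : ℝ} (ht : t ∈ Icc (-1 : ℝ) 0) : IsCopula (giniInf t) where
  toHasCopulaBoundary :=
    (isQuasiCopula_giniInf ⟨ht.1, ht.2.trans zero_le_one⟩).toHasCopulaBoundary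
  two_increasing u₁ u₂ v₁ v₂ hu hv := by
    have hu' : (u₁ : ℝ) ≤ u₂ := hu
    have hv' : (v₁ : ℝ) ≤ v₂ := hv
    simp only [giniInf_eq_of_nonpos ht]
    have w₂₂ := le_max_left (copulaW u₂ v₂) (giniBound t u₂ v₂)
    have k₂₂ := le_max_right (copulaW u₂ v₂) (giniBound t u₂ v₂)
    have w₁₁ := le_max_left (copulaW u₁ v₁) (giniBound t u₁ v₁)
    have k₁₁ := le_max_right (copulaW u₁ v₁) (giniBound t u₁ v₁)
    have z₁₁ : 0 ≤ copulaW u₁ v₁ := le_max_left _ _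
    have z₂₂ : (u₂ : ℝ) + v₂ - 1 ≤ copulaW u₂ v₂ := le_max_right _ _
    obtain ⟨m₁, l₁⟩ := giniBound_mono_and_lipschitz_left ht.2 u₁.2.1 hu' u₂.2.2 v₁.2
    obtain ⟨m₂, l₂⟩ := giniBound_mono_and_lipschitz_left ht.2 u₁.2.1 hu' u₂.2.2 v₂.2
    obtain ⟨n₁, q₁⟩ := giniBound_mono_and_lipschitz_right ht.2 v₁.2.1 hv' v₂.2.2 u₁.2
    obtain ⟨n₂, q₂⟩ := giniBound_mono_and_lipschitz_right ht.2 v₁.2.1 hv' v₂.2.2 u₂.2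
    rcases le_or_gt (giniBound t u₂ v₁) (copulaW u₂ v₁) with h | h <;>
    rcases le_or_gt (giniBound t u₁ v₂) (copulaW u₁ v₂) with h' | h'
    · rw [max_eq_left h, max_eq_left h']
      linarith [isCopula_copulaW.two_increasing u₁ u₂ v₁ v₂ hu hv]
    · rw [max_eq_left h, max_eq_right h'.le]
      -- If W(u₂, v₁) = 0, monotonicity of `giniBound` in u suffices. Otherwise compare with u₂ + v₂
      -- - 1 at the top corner and use the Lipschitz bound in v.
      rcases max_choice (0 : ℝ) ((u₂ : ℝ) + v₁ - 1) with e | e <;>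
      rw [copulaW.eq_1 u₂ v₁, e] <;> linarith
    · rw [max_eq_right h.le, max_eq_left h']
      rcases max_choice (0 : ℝ) ((u₁ : ℝ) + v₂ - 1) with e | e <;>
      rw [copulaW.eq_1 u₁ v₂, e] <;> linarith
    · rw [max_eq_right h.le, max_eq_right h'.le]
      have r₁ := Real.abs_le_sqrt (sq_sub_le_of_copulaW_lt_giniBound ht.2 h)
      have r₂ := Real.abs_le_sqrt (sq_sub_le_of_copulaW_lt_giniBound ht.2 h')
      have := giniBound_two_increasing (ht.2.trans_lt one_pos) (Real.sq_sqrt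
        (show 0 ≤ (1 - t) / 3 by linarith [ht.2])).le hu' hv' (le_of_abs_le r₁)
        (by rw [abs_sub_comm] at r₂; exact le_of_abs_le r₂)
      linarith

/-! ### Comparison with W and M -/

theorem giniInf_eq_copulaW {t : ℝ} (ht : t ∈ Icc (-1 : ℝ) (-(1 / 2))) : giniInf t = copulaW := by
  funext a b
  have ht₀ : t ∈ Icc (-1 : ℝ) 0 := ⟨ht.1, by linarith [ht.2]⟩
  rw [giniInf_eq_of_nonpos ht₀]
  refine max_eq_left (not_lt.1 fun h => ?_)
  have h₁ := (le_max_left _ _).trans_lt h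
  have h₂ := (le_max_right _ _).trans_lt h
  have h₃ : √(giniRadicand t a b) < 1 / 2 := by
    unfold giniBound at h₁ h₂
    linarith
  rw [Real.sqrt_lt' (by norm_num), giniRadicand] at h₃
  nlinarith [sq_nonneg (1 - (a : ℝ) - b), sq_nonneg ((a : ℝ) - b), ht.2]

theorem giniInf_ne_copulaW {t : ℝ} (ht : t ∈ Ioc (-(1 / 2) : ℝ) 1) : giniInf t ≠ copulaW := by
  intro h
  have h' := giniBound_le_giniInf ⟨by linarith [ht.1], ht.2⟩
    ⟨1 / 2, by norm_num, by norm_num⟩ ⟨1 / 2, by norm_num, by norm_num⟩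
  rw [h, copulaW, giniBound, giniRadicand] at h'
  rw [max_eq_left (by norm_num), sub_le_iff_le_add, zero_add] at h'
  norm_num only at h'
  rw [Real.le_sqrt' (by norm_num)] at h'
  linarith [ht.1]

theorem giniInf_ne_copulaM {t : ℝ} (ht : t ∈ Ico (-1 : ℝ) 1) : giniInf t ≠ copulaM := by
  intro h
  have hm : giniGamma _ = _ :=
    isCopula_copulaM.giniGamma_convexCombination isCopula_copulaW ((1 + t) / 2)
  rw [giniGamma_copulaM, giniGamma_copulaW] at hm
  have h' := giniInf_le ⟨isCopula_copulaM.convexCombination isCopula_copulaW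
    (r := (1 + t) / 2) (by linarith [ht.1]) (by linarith [ht.2]), hm.trans (by ring)⟩
    ⟨1 / 2, by norm_num, by norm_num⟩ ⟨1 / 2, by norm_num, by norm_num⟩
  rw [h, copulaM, copulaW] at h'
  norm_num at h'
  linarith [ht.2]

theorem giniInf_one : giniInf 1 = copulaM := by
  have h₁ : (1 : ℝ) ∈ Icc (-1 : ℝ) 1 := by norm_num
  funext u v
  refine le_antisymm (giniInf_le ⟨isCopula_copulaM, giniGamma_copulaM⟩ u v)
    (le_giniInf h₁ fun C hC => ?_)
  have hdiag : ∀ a : I, (a : ℝ) ≤ C a a := fun a => by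
    obtain ⟨-, hda, -, -⟩ := hC.1.bounds a a
    have := hC.1.giniGamma_le_of_diag a a
    rw [hC.2] at this
    nlinarith
  rcases le_total u v with h | h
  · exact (min_le_left _ _).trans ((hdiag u).trans (hC.1.mono_right u h))
  · exact (min_le_right _ _).trans ((hdiag v).trans (hC.1.mono_left v h))

/-! ### A square of negative volume for 0 < t < 1 -/

/-- Here k = (1 - t)/6. The last three conclusions give negative volume, positivity of `giniBound`
at the lower left corner, and bracketing of the kinks there. All are strict at ε = 0, hence persist
for small ε. -/
theorem exists_square_parameters {k : ℝ} (h₀ : 0 < k) (h₁ : k < 1 / 6) :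
    ∃ δ ε : ℝ, 0 < δ ∧ 0 < ε ∧ ε < (1 - δ) / 2 ∧ 2 * k + 2 * ε ^ 2 < δ ^ 2 ∧
      √(k + 2 * ε ^ 2 / 3 + δ ^ 2 / 4) < 1 / 2 - ε ∧
      δ / 2 + 2 * ε < √(k + 2 * ε ^ 2 / 3 + δ ^ 2 / 4) := by
  -- δ² = 1/2 - k is the midpoint of the admissible interval (2k, 1 - 4k), nonempty exactly when k <
  -- 1/6.
  have hδ := Real.sq_sqrt (show 0 ≤ 1 / 2 - k by linarith)
  have hδ₀ := Real.sqrt_pos.2 (show 0 < 1 / 2 - k by linarith)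
  have hδ₁ : √(1 / 2 - k) < 1 := by rw [Real.sqrt_lt' one_pos]; linarith
  generalize √(1 / 2 - k) = δ at *
  have c : Continuous fun ε : ℝ => √(k + 2 * ε ^ 2 / 3 + δ ^ 2 / 4) := by fun_prop
  have e₁ : ∀ᶠ ε in nhds (0 : ℝ), ε < (1 - δ) / 2 := by
    refine continuous_id.continuousAt.eventually_lt continuousAt_const ?_
    simp only [id]; linarith
  have e₂ : ∀ᶠ ε in nhds (0 : ℝ), 2 * k + 2 * ε ^ 2 < δ ^ 2 := by
    refine ContinuousAt.eventually_lt (by fun_prop) continuousAt_const ?_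
    norm_num; linarith
  have e₃ : ∀ᶠ ε in nhds (0 : ℝ), √(k + 2 * ε ^ 2 / 3 + δ ^ 2 / 4) < 1 / 2 - ε := by
    refine c.continuousAt.eventually_lt (by fun_prop) ?_
    rw [Real.sqrt_lt' (by norm_num)]
    norm_num; linarith
  have e₄ : ∀ᶠ ε in nhds (0 : ℝ), δ / 2 + 2 * ε < √(k + 2 * ε ^ 2 / 3 + δ ^ 2 / 4) := by
    refine ContinuousAt.eventually_lt (by fun_prop) c.continuousAt ?_
    apply Real.lt_sqrt_of_sq_lt
    nlinarith
  obtain ⟨ε, ⟨⟨⟨h₁, h₂⟩, h₃⟩, h₄⟩, h₅⟩ := ((((e₁.and e₂).and e₃).and e₄).filter_mono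
    nhdsWithin_le_nhds |>.and (self_mem_nhdsWithin (s := Ioi (0 : ℝ)))).exists
  exact ⟨δ, ε, hδ₀, h₅, h₁, h₂, h₃, h₄⟩

/-- With p, q, r the three roots, p + q ≥ 2r would give (p - q)² ≤ 4ε²/3; multiplied by the bound
for (p + q)², this contradicts p² - q² = 2δε. -/
theorem sqrt_add_sqrt_lt {k δ ε : ℝ} (hk : 0 < k) (hε : 0 < ε) (h : 2 * k + 2 * ε ^ 2 < δ ^ 2) :
    √(k + (δ + 2 * ε) ^ 2 / 4) + √(k + (δ - 2 * ε) ^ 2 / 4) <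
      2 * √(k + 2 * ε ^ 2 / 3 + δ ^ 2 / 4) := by
  have hp := Real.sq_sqrt (show 0 ≤ k + (δ + 2 * ε) ^ 2 / 4 by positivity)
  have hq := Real.sq_sqrt (show 0 ≤ k + (δ - 2 * ε) ^ 2 / 4 by positivity)
  have hr := Real.sq_sqrt (show 0 ≤ k + 2 * ε ^ 2 / 3 + δ ^ 2 / 4 by positivity)
  have hr₀ := Real.sqrt_nonneg (k + 2 * ε ^ 2 / 3 + δ ^ 2 / 4)
  generalize √(k + (δ + 2 * ε) ^ 2 / 4) = p at *
  generalize √(k + (δ - 2 * ε) ^ 2 / 4) = q at *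
  generalize √(k + 2 * ε ^ 2 / 3 + δ ^ 2 / 4) = r at *
  by_contra! hc
  have h₁ : (2 * r) ^ 2 ≤ (p + q) ^ 2 := pow_le_pow_left₀ (by positivity) hc 2
  have h₂ : (p - q) ^ 2 ≤ 4 / 3 * ε ^ 2 := by linarith
  have h₃ : (p + q) ^ 2 ≤ 4 * k + δ ^ 2 + 4 * ε ^ 2 := by linarith [sq_nonneg (p - q)]
  have h₄ : (p - q) ^ 2 * (p + q) ^ 2 = 4 * δ ^ 2 * ε ^ 2 := by
    have : p ^ 2 - q ^ 2 = 2 * δ * ε := by linarith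
    calc (p - q) ^ 2 * (p + q) ^ 2 = (p ^ 2 - q ^ 2) ^ 2 := by ring
      _ = _ := by rw [this]; ring
  have h₅ := mul_le_mul h₂ h₃ (sq_nonneg _) (by positivity)
  rw [h₄] at h₅
  have h₆ := mul_pos (pow_pos hε 2) (sub_pos.2 h)
  linarith

theorem not_isCopula_giniInf {t : ℝ} (ht : t ∈ Ioo (0 : ℝ) 1) : ¬ IsCopula (giniInf t) := by
  intro hG
  have htI : t ∈ Icc (-1 : ℝ) 1 := ⟨by linarith [ht.1], ht.2.le⟩
  have hk₀ : 0 < (1 - t) / 6 := by linarith [ht.2]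
  obtain ⟨δ, ε, hδ, hε, h₁, h₂, h₃, h₄⟩ :=
    exists_square_parameters hk₀ (show (1 - t) / 6 < 1 / 6 by linarith [ht.1])
  set a : I := ⟨(1 + δ) / 2 - ε, by linarith, by linarith⟩ with ha
  set a' : I := ⟨(1 + δ) / 2 + ε, by linarith, by linarith⟩ with ha'
  set b : I := ⟨(1 - δ) / 2 - ε, by linarith, by linarith⟩ with hb
  set b' : I := ⟨(1 - δ) / 2 + ε, by linarith, by linarith⟩ with hb'
  have hab : giniBound t a b = 1 / 2 - ε - √((1 - t) / 6 + 2 * ε ^ 2 / 3 + δ ^ 2 / 4) := by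
    simp only [giniBound, giniRadicand, ha, hb]
    congr 2 <;> ring
  have ha'b : giniBound t a' b = 1 / 2 - √((1 - t) / 6 + (δ + 2 * ε) ^ 2 / 4) := by
    simp only [giniBound, giniRadicand, ha', hb]
    congr 2 <;> ring
  have hab' : giniBound t a b' = 1 / 2 - √((1 - t) / 6 + (δ - 2 * ε) ^ 2 / 4) := by
    simp only [giniBound, giniRadicand, ha, hb']
    congr 2 <;> ring
  have g₁ := (giniInf_le_of_giniBound_le htI (a := a) (b := b) (d := giniBound t a b)
    (by linarith) (giniBound_le_left ht.2.le) (giniBound_le_right ht.2.le)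
    (by simp only [ha, hb]; linarith) (by rw [hab]; simp only [ha, hb]; linarith)
    (by rw [hab]; simp only [ha, hb]; linarith) le_rfl).1
  -- The square is symmetric about the antidiagonal point ((1 + δ)/2, (1 - δ)/2), so (a', b') is the
  -- central reflection of (b, a), and the survival bound reaches the upper right corner. The other
  -- two corners need only the lower bound `giniBound`.
  have g₂ := (giniInf_le_of_giniBound_le htI (a := b) (b := a) (d := giniBound t a b)
    (by linarith) (giniBound_le_right ht.2.le) (giniBound_le_left ht.2.le)
    (by simp only [ha, hb]; linarith) (by rw [hab]; simp only [ha, hb]; linarith)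
    (by rw [hab]; simp only [ha, hb]; linarith) giniBound_swap.le).2
  have eb : σ b = a' := Subtype.ext (by simp only [unitInterval.coe_symm_eq, hb, ha']; ring)
  have ea : σ a = b' := Subtype.ext (by simp only [unitInterval.coe_symm_eq, hb', ha]; ring)
  rw [ea, eb] at g₂
  have e : 1 - (b : ℝ) - a = 2 * ε := by simp only [ha, hb]; ring
  rw [e] at g₂
  have g₃ := giniBound_le_giniInf htI a' b
  have g₄ := giniBound_le_giniInf htI a b'
  have hv := hG.two_increasing a a' b b' (Subtype.mk_le_mk.2 (by linarith))
    (Subtype.mk_le_mk.2 (by linarith))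
  have := sqrt_add_sqrt_lt hk₀ hε h₂
  linarith

theorem mainTheorem4 :
    giniInf 1 = copulaM ∧
    ∀ t : ℝ, t ∈ Set.Icc (-1 : ℝ) 1 →
      (IsProperQuasiCopula (giniInf t) ↔ 0 < t ∧ t < 1) ∧
      ((IsCopula (giniInf t) ∧ giniInf t ≠ copulaM ∧ giniInf t ≠ copulaW) ↔
        -(1 / 2 : ℝ) < t ∧ t ≤ 0) ∧
      (giniInf t = copulaW ↔ -1 ≤ t ∧ t ≤ -(1 / 2 : ℝ)) := by
  refine ⟨giniInf_one, fun t ht => ⟨⟨fun h => ?_, fun h => ?_⟩, ⟨fun h => ?_, fun h => ?_⟩,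
    ⟨fun h => ⟨ht.1, ?_⟩, fun h => giniInf_eq_copulaW h⟩⟩⟩
  · refine ⟨not_le.1 fun h' => h.2 (isCopula_giniInf_of_nonpos ⟨ht.1, h'⟩),
      ht.2.lt_of_ne ?_⟩
    rintro rfl
    exact h.2 (giniInf_one ▸ isCopula_copulaM)
  · exact ⟨isQuasiCopula_giniInf ht, not_isCopula_giniInf h⟩
  · obtain ⟨hC, hM, hW⟩ := h
    refine ⟨not_le.1 fun h' => hW (giniInf_eq_copulaW ⟨ht.1, h'⟩), not_lt.1 fun h' => ?_⟩
    refine not_isCopula_giniInf ⟨h', ht.2.lt_of_ne ?_⟩ hC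
    rintro rfl
    exact hM giniInf_one
  · exact ⟨isCopula_giniInf_of_nonpos ⟨ht.1, h.2⟩,
      giniInf_ne_copulaM ⟨ht.1, h.2.trans_lt one_pos⟩,
      giniInf_ne_copulaW ⟨h.1, ht.2⟩⟩
  · exact not_lt.1 fun h' => giniInf_ne_copulaW ⟨h', ht.2⟩ h
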